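/- Let $\mathbb R^*=\mathbb R\setminus\{0\}$ and $\mathcal Y=(-1,1)\setminus\{0\}$. Let $\pi:\mathbb R\to[0,\infty)$ be a (possibly unnormalized) target density, i.e. measurable with $0<\int_{\mathbb R}\pi(x)\,dx<\infty$, and write also $\pi(B)=\int_B\pi(x)\,dx\big/\int_{\mathbb R}\pi(x)\,dx$ for the corresponding probability measure. Let $g$ be a probability density on $\mathcal Y$. The (symmetric) random dive Metropolis--Hastings (RDMH) chain is the Markov chain on $\mathbb R^*$, with transition kernel $K$, which moves from a state $x$ as follows: draw $\epsilon\sim g$; independently, with probability $1/2$ each, either propose $x'=x\epsilon$ and put $\alpha=\min\{\frac{\pi(x')}{\pi(x)}|\epsilon|,1\}$, or propose $x'=x/\epsilon$ and put $\alpha=\min\{\frac{\pi(x')}{\pi(x)}\frac1{|\epsilon|},1\}$; then move to $x'$ with probability $\alpha$ and stay at $x$ with probability $1-\alpha$. Suppose that $\inf_{\delta<|\epsilon|<1}g(\epsilon)>0$ for every $0<\delta<1$, and that on every compact subset of $\mathbb R$ the function $\pi$ is bounded and (pointwise) positive. Then the RDMH chain $(X_n)_{n\ge0}$ is Harris recurrent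 on $\mathbb R^*$: for every $x\in\mathbb R^*$ and every Borel set $B\subseteq\mathbb R^*$ with $\pi(B)>0$, $$P(\exists\, n\ge 1:\ X_n\in B\mid X_0=x)=1 .$$ Consequently, for every $x\in\mathbb R^*$, $$\|K^n(x,\cdot)-\pi(\cdot)\|_{TV}=\sup_{A}|K^n(x,A)-\pi(A)|\longrightarrow 0\qquad (n\to\infty),$$ the supremum being over all Borel sets $A\subseteq\mathbb R^*$. -/

import Mathlib

open MeasureTheory ProbabilityTheory Filter Topology
open scoped ENNReal

/-- A target density on `ℝ`, possibly unnormalized: a nonnegative, measurable, integrable function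
with positive total integral. -/
structure TargetDensity where
  toFun : ℝ → ℝ
  measurable : Measurable toFun
  nonneg : ∀ x, 0 ≤ toFun x
  integrable : Integrable toFun volume
  integral_pos : 0 < ∫ x, toFun x

instance : CoeFun TargetDensity (fun _ => ℝ → ℝ) := ⟨TargetDensity.toFun⟩

/-- A probability density on `𝒴 = (-1, 1) ∖ {0}`; values outside `𝒴` play no role. -/
structure DiveDensity where
  toFun : ℝ → ℝ
  measurable : Measurable toFun
  nonneg : ∀ ε ∈ Set.Ioo (-1 : ℝ) 1 \ {0}, 0 ≤ toFun ε
  integral_eq_one : ∫ ε in Set.Ioo (-1 : ℝ) 1 \ {0}, toFun ε = 1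

instance : CoeFun DiveDensity (fun _ => ℝ → ℝ) := ⟨DiveDensity.toFun⟩

/-- The state space `ℝ* = ℝ ∖ {0}`, with its Borel sigma-algebra. -/
abbrev RStar : Type := ↥({0}ᶜ : Set ℝ)

namespace RStar

/-- The proposal `x * ε` of an inner dive. -/
def inner (x ε : RStar) : RStar := ⟨x.1 * ε.1, mul_ne_zero x.2 ε.2⟩

/-- The proposal `x / ε` of an outer dive. -/
noncomputable def outer (x ε : RStar) : RStar := ⟨x.1 / ε.1, div_ne_zero x.2 ε.2⟩

theorem measurable_inner : Measurable (fun p : RStar × RStar => inner p.1 p.2) := by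
  unfold inner
  fun_prop

theorem measurable_outer : Measurable (fun p : RStar × RStar => outer p.1 p.2) := by
  unfold outer
  fun_prop

end RStar

/-- The normalized target distribution on `ℝ`: the probability measure with density
`π / ∫ π`. -/
noncomputable def TargetDensity.law (π : TargetDensity) : Measure ℝ :=
  volume.withDensity (fun x => ENNReal.ofReal (π x / ∫ y, π y))

/-- The target distribution as a measure on `ℝ*` (the origin is a null set). -/
noncomputable def TargetDensity.lawStar (π : TargetDensity) : Measure RStar :=
  π.law.comap Subtype.val

/-- The law of the multiplier `ε ∼ g`, on `𝒴 ⊆ ℝ*`. -/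
noncomputable def DiveDensity.law (g : DiveDensity) : Measure RStar :=
  ((volume.restrict (Set.Ioo (-1 : ℝ) 1 \ {0})).withDensity
    (fun ε => ENNReal.ofReal (g ε))).comap Subtype.val

instance (π : TargetDensity) : IsProbabilityMeasure π.law := by
  refine ⟨?_⟩
  rw [TargetDensity.law, withDensity_apply _ MeasurableSet.univ, Measure.restrict_univ,
    ← ofReal_integral_eq_lintegral_ofReal (π.integrable.div_const _)
      (ae_of_all _ fun x => div_nonneg (π.nonneg x) π.integral_pos.le),
    integral_div, div_self π.integral_pos.ne', ENNReal.ofReal_one]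

instance (π : TargetDensity) : IsProbabilityMeasure π.lawStar := by
  refine ⟨?_⟩
  rw [TargetDensity.lawStar,
    (MeasurableEmbedding.subtype_coe (measurableSet_singleton (0 : ℝ)).compl).comap_apply,
    Set.image_univ, Subtype.range_coe, prob_compl_eq_one_iff (measurableSet_singleton _),
    TargetDensity.law]
  exact withDensity_absolutelyContinuous _ _ (by simp)

instance (g : DiveDensity) : IsProbabilityMeasure g.law := by
  have hS : MeasurableSet (Set.Ioo (-1 : ℝ) 1 \ {0}) :=
    measurableSet_Ioo.diff (measurableSet_singleton _)
  have hint : Integrable g.toFun (volume.restrict (Set.Ioo (-1 : ℝ) 1 \ {0})) := by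
    by_contra h
    have := g.integral_eq_one
    rw [integral_undef h] at this
    exact zero_ne_one this
  have hsub : (Set.Ioo (-1 : ℝ) 1 \ {0}) ⊆ ({0}ᶜ : Set ℝ) := fun x hx => hx.2
  refine ⟨?_⟩
  rw [DiveDensity.law,
    (MeasurableEmbedding.subtype_coe (measurableSet_singleton (0 : ℝ)).compl).comap_apply,
    Set.image_univ, Subtype.range_coe,
    withDensity_apply _ (measurableSet_singleton (0 : ℝ)).compl,
    Measure.restrict_restrict (measurableSet_singleton (0 : ℝ)).compl,
    Set.inter_eq_right.2 hsub,
    ← ofReal_integral_eq_lintegral_ofReal hint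
      ((ae_restrict_iff' hS).2 (ae_of_all _ g.nonneg)), g.integral_eq_one, ENNReal.ofReal_one]

/-- Acceptance probability of an inner dive, `min {π(xε)/π(x) · |ε|, 1}`. -/
noncomputable def innerAccept (π : TargetDensity) (x ε : RStar) : ℝ :=
  min (π (x.inner ε) / π x * |ε.1|) 1

/-- Acceptance probability of an outer dive, `min {π(x/ε)/π(x) · 1/|ε|, 1}`. -/
noncomputable def outerAccept (π : TargetDensity) (x ε : RStar) : ℝ :=
  min (π (x.outer ε) / π x * (1 / |ε.1|)) 1

/-- The law of the new state when `x'` is accepted with probability `α` and the old state `x` is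
kept otherwise. -/
noncomputable def acceptReject (α : ℝ) (x' x : RStar) : Measure RStar :=
  ENNReal.ofReal α • Measure.dirac x' + ENNReal.ofReal (1 - α) • Measure.dirac x

/-- The law of the next state given the current state `x` and the multiplier `ε`: an inner or an
outer dive with probability `1/2` each, followed by acceptance or rejection. -/
noncomputable def diveStep (π : TargetDensity) (x ε : RStar) : Measure RStar :=
  (1 / 2 : ℝ≥0∞) • acceptReject (innerAccept π x ε) (x.inner ε) x +
    (1 / 2 : ℝ≥0∞) • acceptReject (outerAccept π x ε) (x.outer ε) x

theorem isProbabilityMeasure_acceptReject {α : ℝ} (h0 : 0 ≤ α) (h1 : α ≤ 1) (x' x : RStar) :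
    IsProbabilityMeasure (acceptReject α x' x) := by
  refine ⟨?_⟩
  simp [acceptReject, ← ENNReal.ofReal_add h0 (sub_nonneg.2 h1)]

theorem measurable_acceptReject {a : RStar × RStar → ℝ} {f : RStar × RStar → RStar}
    (ha : Measurable a) (hf : Measurable f) :
    Measurable (fun p => acceptReject (a p) (f p) p.1) := by
  refine Measure.measurable_of_measurable_coe _ fun s hs => ?_
  have h1 : Measurable (fun p => s.indicator (1 : RStar → ℝ≥0∞) (f p)) :=
    (measurable_one.indicator hs).comp hf
  have h2 : Measurable (fun p : RStar × RStar => s.indicator (1 : RStar → ℝ≥0∞) p.1) :=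
    (measurable_one.indicator hs).comp measurable_fst
  simp only [acceptReject, Measure.add_apply, Measure.smul_apply, smul_eq_mul,
    Measure.dirac_apply' _ hs]
  fun_prop

theorem measurable_innerAccept (π : TargetDensity) :
    Measurable (fun p : RStar × RStar => innerAccept π p.1 p.2) := by
  have h := π.measurable
  have h2 : Measurable (fun p : RStar × RStar => π (p.1.inner p.2)) :=
    h.comp (measurable_subtype_coe.comp RStar.measurable_inner)
  unfold innerAccept
  fun_prop

theorem measurable_outerAccept (π : TargetDensity) :
    Measurable (fun p : RStar × RStar => outerAccept π p.1 p.2) := by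
  have h := π.measurable
  have h2 : Measurable (fun p : RStar × RStar => π (p.1.outer p.2)) :=
    h.comp (measurable_subtype_coe.comp RStar.measurable_outer)
  unfold outerAccept
  fun_prop

/-- `diveStep` as a kernel in the pair `(x, ε)`. -/
noncomputable def diveStepKernel (π : TargetDensity) : Kernel (RStar × RStar) RStar where
  toFun p := diveStep π p.1 p.2
  measurable' := by
    have h1 := measurable_acceptReject (measurable_innerAccept π) RStar.measurable_inner
    have h2 := measurable_acceptReject (measurable_outerAccept π) RStar.measurable_outer
    refine Measure.measurable_of_measurable_coe _ fun s hs => ?_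
    have h1' := (Measure.measurable_coe hs).comp h1
    have h2' := (Measure.measurable_coe hs).comp h2
    simp only [diveStep, Measure.add_apply, Measure.smul_apply, smul_eq_mul]
    exact (h1'.const_mul _).add (h2'.const_mul _)

instance (π : TargetDensity) : IsMarkovKernel (diveStepKernel π) := by
  refine ⟨fun p => ⟨?_⟩⟩
  have hi := isProbabilityMeasure_acceptReject (α := innerAccept π p.1 p.2)
    (le_min (mul_nonneg (div_nonneg (π.nonneg _) (π.nonneg _)) (abs_nonneg _)) zero_le_one)
    (min_le_right _ _) (p.1.inner p.2) p.1
  have ho := isProbabilityMeasure_acceptReject (α := outerAccept π p.1 p.2)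
    (le_min (mul_nonneg (div_nonneg (π.nonneg _) (π.nonneg _)) (by positivity)) zero_le_one)
    (min_le_right _ _) (p.1.outer p.2) p.1
  change diveStep π p.1 p.2 Set.univ = 1
  rw [diveStep, Measure.add_apply, Measure.smul_apply, Measure.smul_apply,
    hi.measure_univ, ho.measure_univ]
  simp [ENNReal.inv_two_add_inv_two]

/-- The transition kernel `K` of the (symmetric) random dive Metropolis-Hastings chain on `ℝ*`:
draw `ε ∼ g`, then make the step `diveStep` from the current state. -/
noncomputable def rdmhKernel (π : TargetDensity) (g : DiveDensity) : Kernel RStar RStar :=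
  (diveStepKernel π).comp (Kernel.id.prod (Kernel.const RStar g.law))

instance (π : TargetDensity) (g : DiveDensity) : IsMarkovKernel (rdmhKernel π g) := by
  unfold rdmhKernel
  infer_instance

theorem rdmhKernel_apply (π : TargetDensity) (g : DiveDensity) (x : RStar) {A : Set RStar}
    (hA : MeasurableSet A) : rdmhKernel π g x A = ∫⁻ ε, diveStep π x ε A ∂g.law := by
  have h : Measurable fun p : RStar × RStar => diveStepKernel π p A :=
    Kernel.measurable_coe _ hA
  rw [rdmhKernel, Kernel.comp_apply' _ _ _ hA, Kernel.prod_apply, Kernel.id_apply,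
    Kernel.const_apply, Measure.dirac_prod, lintegral_map h (by fun_prop)]
  rfl

section MarkovChain

variable {E : Type*} [MeasurableSpace E]

/-- The law of the path `(X₀, X₁, …)` of the time-homogeneous Markov chain with transition
kernel `κ` started at `X₀ = x`. -/
noncomputable def pathLaw (κ : Kernel E E) [IsMarkovKernel κ] (x : E) : Measure (ℕ → E) :=
  Kernel.traj (X := fun _ => E)
    (fun n => κ.comap (fun h : (i : Finset.Iic n) → E => h ⟨n, Finset.mem_Iic.2 le_rfl⟩)
      (measurable_pi_apply _)) 0 (fun _ => x)

/-- Harris recurrence with respect to `μ`: from every starting point, every measurable set of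
positive `μ`-measure is almost surely visited (at some time `n ≥ 1`). -/
def IsHarrisRecurrent (κ : Kernel E E) [IsMarkovKernel κ] (μ : Measure E) : Prop :=
  ∀ (x : E) (B : Set E), MeasurableSet B → 0 < μ B →
    pathLaw κ x {ω | ∃ n, 1 ≤ n ∧ ω n ∈ B} = 1

/-- Total variation distance `sup_A |μ(A) - ν(A)|` of two probability measures. -/
noncomputable def tvDistance (μ ν : Measure E) : ℝ :=
  ⨆ A : {A : Set E // MeasurableSet A}, |μ.real A.1 - ν.real A.1|

end MarkovChain

/-!
In the multiplicative coordinates of `ℝ*`, with Haar measure `dy / |y|`, the dive moves are a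
Metropolis algorithm for the density `p(x) = π(x) |x|`: substituting `y = x ε` and `y = x / ε` gives
the symmetric proposal density `q(x, y) = (h(y / x) + h(x / y)) / 2` with `h(t) = g(t) |t|`, and
both acceptance probabilities become `min (p(y) / p(x)) 1`. Hence
`K(x, ·) = k(x, ·) · π + r(x) δ_x`, where `k(x, y)` is `q(x, y) / max (p(x)) (p(y))` up to a
constant (`rdmhKernel_eq`). The density `k` is symmetric, so `K` is reversible, and it is positive
off `|y| = |x|`, so `π ≪ K(x, ·)` and `r(x) < 1` for every `x`. Both conclusions hold for every
kernel with these properties.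

*Harris recurrence* (`isHarrisRecurrent_of_invariant`). Let `h(x)` be the probability of never
visiting `B` after time `0`, and let `f = 1_{Bᶜ} h`. Then `f ≤ h = K f`, and invariance forces
`f = h` almost everywhere. So `K f` vanishes at some point of `B`, and since the one-step law from
that point dominates `π`, `f = 0` almost everywhere. Therefore `h(x) = K f (x) = r(x) f(x) ≤
r(x) h(x)`, and `h(x) = 0` for every `x`.

*Convergence* (`tendsto_tvDistance_pow`). For a set `S` let `f_n(x) = Kⁿ(x, S)`. The integrals
`∫ f_n² dπ` decrease, and their decrements are the `π`-averages over `x` of the variances of `f_n`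
under `K(x, ·)`. Along a subsequence these variances tend to zero for some fixed `x`, so `f_n`
minus suitable constants tends to zero `K(x, ·)`-almost everywhere, hence `π`-almost everywhere.
The constants must approach `π(S)`, and `∫ |f_n - π(S)| dπ` decreases, so it tends to zero
(`tendsto_integral_abs_sub_average`). By reversibility
`∫_S (Kⁿ(y, A) - π(A)) π(dy) = ∫_A (Kⁿ(y, S) - π(S)) π(dy)`, which makes the convergence uniform
in `A` for the starting density `1_S`, and by density in `L¹` for all starting densities
(`eventually_abs_integral_pow_sub_le`). Splitting the first step from `x` into its absolutely
continuous part and the atom `r(x) δ_x` gives `e_{n+1} ≤ o(1) + r(x) e_n` for the distance `e_n`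
from `x`.
-/

/-! ### Harris recurrence -/

section Harris

variable {E : Type*} [MeasurableSpace E] {κ : Kernel E E} [IsMarkovKernel κ] {μ : Measure E}

/-- The Markov property of the path law: on an event determined by the path up to time `n`, a
function of `X_{n+1}` may be replaced by its conditional expectation given `X_n`. -/
theorem setLIntegral_pathLaw_succ (x : E) (n : ℕ) {D : Set (Finset.Iic n → E)}
    (hD : MeasurableSet D) {φ : E → ℝ≥0∞} (hφ : Measurable φ) :
    ∫⁻ ω in Preorder.frestrictLe (π := fun _ => E) n ⁻¹' D, φ (ω (n + 1)) ∂pathLaw κ x =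
      ∫⁻ ω in Preorder.frestrictLe (π := fun _ => E) n ⁻¹' D,
        ∫⁻ y, φ y ∂κ (ω n) ∂pathLaw κ x := by
  let η : (n : ℕ) → Kernel (Finset.Iic n → E) E := fun n =>
    κ.comap (fun h : (i : Finset.Iic n) → E => h ⟨n, Finset.mem_Iic.2 le_rfl⟩)
      (measurable_pi_apply _)
  let x₀ : Finset.Iic 0 → E := fun _ => x
  have hmap := Kernel.partialTraj_compProd_eq_map_traj (X := fun _ => E) (κ := η)
    (Nat.zero_le n) (x₀ := x₀)
  have hfr := Kernel.traj_map_frestrictLe_apply (X := fun _ => E) (κ := η) 0 n x₀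
  have hm : Measurable (Preorder.frestrictLe (π := fun _ => E) n) :=
    Preorder.measurable_frestrictLe _
  have hF : Measurable (fun p : (Finset.Iic n → E) × E => D.indicator 1 p.1 * φ p.2) :=
    ((measurable_one.indicator hD).comp measurable_fst).mul (hφ.comp measurable_snd)
  have h1 : ∫⁻ ω in Preorder.frestrictLe (π := fun _ => E) n ⁻¹' D, φ (ω (n + 1)) ∂pathLaw κ x =
      ∫⁻ p, D.indicator 1 p.1 * φ p.2
        ∂((Kernel.traj (X := fun _ => E) η 0 x₀).map
          (fun ω => (Preorder.frestrictLe n ω, ω (n + 1)))) := by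
    rw [lintegral_map hF (by fun_prop), ← lintegral_indicator (hm hD)]
    refine lintegral_congr fun ω => ?_
    by_cases h : Preorder.frestrictLe (π := fun _ => E) n ω ∈ D <;> simp [h]
  have hG : Measurable (fun z : Finset.Iic n → E => D.indicator 1 z *
      ∫⁻ y, φ y ∂η n z) :=
    (measurable_one.indicator hD).mul hφ.lintegral_kernel
  rw [h1, ← hmap, Measure.lintegral_compProd hF, ← hfr]
  simp_rw [lintegral_const_mul _ hφ]
  rw [lintegral_map hG hm, ← lintegral_indicator (hm hD)]
  refine lintegral_congr fun ω => ?_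
  by_cases h : Preorder.frestrictLe (π := fun _ => E) n ω ∈ D
  · simp only [Set.indicator_of_mem h, Pi.one_apply, one_mul, Set.indicator_of_mem
      (show ω ∈ Preorder.frestrictLe (π := fun _ => E) n ⁻¹' D from h)]
    rfl
  · simp [h]

theorem isProbabilityMeasure_pathLaw (x : E) : IsProbabilityMeasure (pathLaw κ x) := by
  unfold pathLaw; infer_instance

theorem lintegral_pathLaw_zero (x : E) {φ : E → ℝ≥0∞} (hφ : Measurable φ) :
    ∫⁻ ω, φ (ω 0) ∂pathLaw κ x = φ x := by
  let η : (n : ℕ) → Kernel (Finset.Iic n → E) E := fun n =>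
    κ.comap (fun h : (i : Finset.Iic n) → E => h ⟨n, Finset.mem_Iic.2 le_rfl⟩)
      (measurable_pi_apply _)
  let x₀ : Finset.Iic 0 → E := fun _ => x
  have hfr := Kernel.traj_map_frestrictLe_apply (X := fun _ => E) (κ := η) 0 0 x₀
  have hm : Measurable (Preorder.frestrictLe (π := fun _ => E) 0) :=
    Preorder.measurable_frestrictLe _
  have hG : Measurable (fun z : Finset.Iic 0 → E => φ (z ⟨0, by simp⟩)) := by fun_prop
  have : ∫⁻ ω, φ (ω 0) ∂pathLaw κ x = ∫⁻ z : Finset.Iic 0 → E, φ (z ⟨0, by simp⟩)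
      ∂((Kernel.traj (X := fun _ => E) η 0 x₀).map (Preorder.frestrictLe 0)) := by
    rw [lintegral_map hG hm]; rfl
  rw [this, hfr, Kernel.partialTraj_self, Kernel.id_apply, lintegral_dirac' _ hG]

/-- The event that a path avoids `B` at the times `1, …, n`. -/
def avoids (B : Set E) (n : ℕ) : Set (ℕ → E) := {ω | ∀ i, 1 ≤ i → i ≤ n → ω i ∉ B}

theorem measurableSet_avoids {B : Set E} (hB : MeasurableSet B) (n : ℕ) :
    MeasurableSet (avoids B n) := by
  have : avoids B n = ⋂ i : ℕ, ⋂ _ : 1 ≤ i, ⋂ _ : i ≤ n, (fun ω : ℕ → E => ω i) ⁻¹' Bᶜ := by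
    ext ω; simp [avoids]
  rw [this]
  exact MeasurableSet.iInter fun i => MeasurableSet.iInter fun _ => MeasurableSet.iInter fun _ =>
    measurable_pi_apply i hB.compl

/-- Avoidance probabilities are iterates of the taboo operator `φ ↦ ∫_{Bᶜ} φ dκ`. -/
theorem setLIntegral_avoids (x : E) {B : Set E} (hB : MeasurableSet B) (n : ℕ) :
    ∀ φ : E → ℝ≥0∞, Measurable φ → ∫⁻ ω in avoids B n, φ (ω n) ∂pathLaw κ x =
      (fun (ψ : E → ℝ≥0∞) y => ∫⁻ z in Bᶜ, ψ z ∂κ y)^[n] φ x := by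
  induction n with
  | zero =>
    intro φ hφ
    have : avoids B 0 = Set.univ := by
      ext ω; simp only [avoids, Set.mem_ofPred_eq, Set.mem_univ, iff_true]; intros; omega
    rw [this, setLIntegral_univ, lintegral_pathLaw_zero x hφ, Function.iterate_zero, id]
  | succ n ih =>
    intro φ hφ
    have hφB : Measurable (Bᶜ.indicator φ) := hφ.indicator hB.compl
    let D : Set (Finset.Iic n → E) := {z | ∀ i : Finset.Iic n, 1 ≤ i.1 → z i ∉ B}
    have hD : MeasurableSet D := by
      have : D = ⋂ i : Finset.Iic n, ⋂ _ : 1 ≤ i.1, (fun z : Finset.Iic n → E => z i) ⁻¹' Bᶜ := by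
        ext z; simp [D]
      rw [this]
      exact MeasurableSet.iInter fun i => MeasurableSet.iInter fun _ =>
        measurable_pi_apply i hB.compl
    have hpre : Preorder.frestrictLe (π := fun _ => E) n ⁻¹' D = avoids B n := by
      ext ω
      simp only [D, avoids, Set.mem_preimage, Set.mem_ofPred_eq, Subtype.forall, Finset.mem_Iic,
        Preorder.frestrictLe_apply]
      exact ⟨fun h i h1 h2 => h i h2 h1, fun h i h1 h2 => h i h2 h1⟩
    have hstep := setLIntegral_pathLaw_succ (κ := κ) x n hD hφB
    rw [hpre] at hstep
    have hsplit : ∫⁻ ω in avoids B (n + 1), φ (ω (n + 1)) ∂pathLaw κ x =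
        ∫⁻ ω in avoids B n, Bᶜ.indicator φ (ω (n + 1)) ∂pathLaw κ x := by
      rw [← lintegral_indicator (measurableSet_avoids hB _),
        ← lintegral_indicator (measurableSet_avoids hB _)]
      refine lintegral_congr fun ω => ?_
      have hiff : ω ∈ avoids B (n + 1) ↔ ω ∈ avoids B n ∧ ω (n + 1) ∈ Bᶜ := by
        constructor
        · exact fun h => ⟨fun i h1 h2 => h i h1 (by omega), h _ (by omega) le_rfl⟩
        · rintro ⟨h, h'⟩ i h1 h2
          obtain h3 | rfl := Nat.le_succ_iff.1 h2
          exacts [h i h1 h3, h']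
      classical
      simp only [Set.indicator_apply, hiff]
      by_cases h1 : ω ∈ avoids B n <;> by_cases h2 : ω (n + 1) ∈ Bᶜ <;> simp [h1, h2]
    rw [hsplit, hstep, Function.iterate_succ_apply]
    simp_rw [lintegral_indicator hB.compl]
    exact ih _ (by simpa only [lintegral_indicator hB.compl] using
      (hφB.lintegral_kernel (κ := κ)))

/-- The probability `h` of never visiting `B` after time `0` is harmonic for the taboo operator.
Only the direction needed for recurrence is recorded: where `h` vanishes, `B` is visited almost
surely. -/
theorem exists_avoidance_function {B : Set E} (hB : MeasurableSet B) :
    ∃ h : E → ℝ≥0∞, Measurable h ∧ (∀ x, h x ≤ 1) ∧ (∀ x, ∫⁻ y in Bᶜ, h y ∂κ x = h x) ∧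
      ∀ x, h x = 0 → pathLaw κ x {ω | ∃ n, 1 ≤ n ∧ ω n ∈ B} = 1 := by
  set T : (E → ℝ≥0∞) → E → ℝ≥0∞ := fun ψ y => ∫⁻ z in Bᶜ, ψ z ∂κ y with hT
  have hTm : ∀ ψ, Measurable ψ → Measurable (T ψ) := fun ψ hψ => by
    simpa only [hT, lintegral_indicator hB.compl] using
      ((hψ.indicator hB.compl).lintegral_kernel (κ := κ))
  have hTmono : Monotone T := fun ψ ψ' h y => lintegral_mono h
  have hT1 : T 1 ≤ 1 := fun y => by
    simp only [hT, Pi.one_apply, lintegral_one, Measure.restrict_apply_univ]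
    exact prob_le_one
  have hanti : Antitone fun n => T^[n] 1 := by
    refine antitone_nat_of_succ_le fun n => ?_
    rw [Function.iterate_succ_apply]
    exact hTmono.iterate n hT1
  have hm : ∀ n, Measurable (T^[n] 1) := by
    intro n
    induction n with
    | zero => exact measurable_one
    | succ n ih => rw [Function.iterate_succ_apply']; exact hTm _ ih
  have hle : ∀ n x, T^[n] 1 x ≤ 1 := fun n x => hanti (Nat.zero_le n) x
  have hinf : ∀ x, (⨅ n, T^[n + 1] 1 x) = ⨅ n, T^[n] 1 x := fun x =>
    Antitone.iInf_nat_add (f := fun n => T^[n] 1 x) (fun _ _ h => hanti h x) 1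
  refine ⟨fun x => ⨅ n, T^[n] 1 x, Measurable.iInf hm, fun x => (iInf_le _ 0).trans (hle 0 x),
    fun x => ?_, fun x hx => ?_⟩
  · rw [lintegral_iInf hm hanti]
    · change _ = ⨅ n, T^[n] 1 x
      rw [← hinf]
      simp only [Function.iterate_succ_apply']
      rfl
    · simp only [Function.iterate_zero, id, Pi.one_apply, lintegral_one]
      exact measure_ne_top _ _
  · have := isProbabilityMeasure_pathLaw (κ := κ) x
    have hset : MeasurableSet {ω : ℕ → E | ∃ n, 1 ≤ n ∧ ω n ∈ B} := by
      have : {ω : ℕ → E | ∃ n, 1 ≤ n ∧ ω n ∈ B} =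
          ⋃ n : ℕ, ⋃ _ : 1 ≤ n, (fun ω : ℕ → E => ω n) ⁻¹' B := by ext; simp
      rw [this]
      exact MeasurableSet.iUnion fun i => MeasurableSet.iUnion fun _ => measurable_pi_apply i hB
    rw [← prob_compl_eq_zero_iff hset, ← le_zero_iff, ← hx]
    refine le_iInf fun n => ?_
    have h1 := setLIntegral_avoids (κ := κ) x hB n 1 measurable_one
    simp only [Pi.one_apply, setLIntegral_one] at h1
    change _ ≤ T^[n] 1 x
    rw [← h1]
    refine measure_mono fun ω hω i h1 _ h3 => hω ⟨i, h1, h3⟩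

/-- A Markov kernel with an invariant law `μ` is Harris recurrent if every one-step law dominates
`μ` and is, up to a holding probability less than one, dominated by `μ`. -/
theorem isHarrisRecurrent_of_invariant (hinv : κ.Invariant μ) [IsFiniteMeasure μ]
    (hac : ∀ x, μ ≪ κ x)
    (hdec : ∀ x, ∃ (ν : Measure E) (c : ℝ≥0∞), c < 1 ∧ ν ≪ μ ∧
      κ x = ν + c • Measure.dirac x) : IsHarrisRecurrent κ μ := by
  intro x B hB hμB
  obtain ⟨h, hm, hle, hharm, hzero⟩ := exists_avoidance_function (κ := κ) hB
  refine hzero x ?_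
  set f := Bᶜ.indicator h with hf
  have hfm : Measurable f := hm.indicator hB.compl
  have hfh : ∀ y, f y ≤ h y := fun y => Set.indicator_le_self _ _ _
  have hKf : ∀ y, ∫⁻ z, f z ∂κ y = h y := fun y => by rw [lintegral_indicator hB.compl, hharm]
  -- `f ≤ h = κ f`, and `f` and `κ f` have the same integral by invariance
  have heq : f =ᵐ[μ] h := by
    refine ae_eq_of_ae_le_of_lintegral_le (ae_of_all _ hfh) ?_ hm.aemeasurable ?_
    · refine ((lintegral_mono fun y => (hfh y).trans (hle y)).trans_lt ?_).ne
      simp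
    · conv_rhs => rw [← hinv.def, Measure.lintegral_bind (Kernel.aemeasurable _) hfm.aemeasurable]
      simp_rw [hKf]; exact le_rfl
  -- at a point of `B` where `f = h`, the function `κ f = h = f` vanishes
  obtain ⟨y, hyB, hy⟩ : ∃ y ∈ B, f y = h y := by
    by_contra! hcon
    exact hμB.ne' (measure_mono_null (fun y hy => hcon y hy) (ae_iff.1 heq))
  have hy0 : ∫⁻ z, f z ∂κ y = 0 := by
    rw [hKf, ← hy, hf, Set.indicator_of_notMem (by simpa using hyB)]
  have hf0 : f =ᵐ[μ] 0 := (hac y).ae_eq ((lintegral_eq_zero_iff hfm).1 hy0)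
  obtain ⟨ν, c, hc, hν, hκ⟩ := hdec x
  have hhx : h x = c * f x := by
    rw [← hKf x, hκ, lintegral_add_measure, lintegral_congr_ae (hν.ae_eq hf0),
      lintegral_smul_measure, lintegral_dirac' _ hfm]
    simp
  by_contra hne
  have hfin : h x ≠ ∞ := ((hle x).trans_lt ENNReal.one_lt_top).ne
  have : h x < h x := calc
    h x = c * f x := hhx
    _ ≤ c * h x := by gcongr; exact hfh x
    _ < 1 * h x := ENNReal.mul_lt_mul_left hne hfin hc
    _ = h x := one_mul _
  exact this.false

end Harris

/-! ### Convergence in total variation -/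

section TotalVariation

variable {E : Type*} [MeasurableSpace E] {κ : Kernel E E} {μ : Measure E}

instance isMarkovKernel_pow [IsMarkovKernel κ] (n : ℕ) : IsMarkovKernel (κ ^ n) := by
  induction n with
  | zero => exact inferInstanceAs (IsMarkovKernel (Kernel.id : Kernel E E))
  | succ n ih => rw [pow_succ]; exact inferInstanceAs (IsMarkovKernel ((κ ^ n) ∘ₖ κ))

theorem measurable_integral_kernel {f : E → ℝ} (hf : Measurable f) [IsMarkovKernel κ] :
    Measurable fun x => ∫ y, f y ∂κ x :=
  hf.stronglyMeasurable.integral_kernel.measurable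

theorem ProbabilityTheory.Kernel.Invariant.integral_integral [IsFiniteMeasure μ]
    [IsMarkovKernel κ]
    (hinv : κ.Invariant μ) {f : E → ℝ} (hf : Integrable f μ) :
    ∫ x, ∫ y, f y ∂κ x ∂μ = ∫ x, f x ∂μ := by
  have h : (κ ∘ₖ Kernel.const Unit μ) () = μ := by
    rw [Kernel.comp_apply, Kernel.const_apply]; exact hinv
  have := Kernel.integral_comp (η := κ) (κ := Kernel.const Unit μ) (a := ()) (f := f)
    (by rwa [h])
  rw [h] at this
  rw [this, Kernel.const_apply]

/-- A sequence of nonnegative functions whose integrals tend to zero has an almost everywhere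
null subsequence. -/
theorem exists_subseq_ae_tendsto_zero {F : ℕ → E → ℝ} (hF0 : ∀ n x, 0 ≤ F n x)
    (hFi : ∀ n, Integrable (F n) μ) (hF : Tendsto (fun n => ∫ x, F n x ∂μ) atTop (𝓝 0)) :
    ∃ ns : ℕ → ℕ, StrictMono ns ∧ ∀ᵐ x ∂μ, Tendsto (fun i => F (ns i) x) atTop (𝓝 0) := by
  refine TendstoInMeasure.exists_seq_tendsto_ae (g := fun _ => (0 : ℝ))
    (tendstoInMeasure_of_tendsto_eLpNorm one_ne_zero (fun n => (hFi n).1)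
      aestronglyMeasurable_const ?_)
  have : ∀ n, eLpNorm (F n - fun _ => (0 : ℝ)) 1 μ = ENNReal.ofReal (∫ x, F n x ∂μ) := by
    intro n
    rw [eLpNorm_one_eq_lintegral_enorm, ofReal_integral_eq_lintegral_ofReal (hFi n)
      (ae_of_all _ (hF0 n))]
    refine lintegral_congr fun x => ?_
    simp [Real.enorm_eq_ofReal (hF0 n x)]
  simp_rw [this]
  simpa using ENNReal.tendsto_ofReal hF

section Mixing

variable [IsProbabilityMeasure μ] [IsMarkovKernel κ] {f : ℕ → E → ℝ}

theorem integrable_of_mem_unitInterval {ν : Measure E} [IsFiniteMeasure ν] {F : E → ℝ}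
    (hF : Measurable F) (h0 : ∀ x, 0 ≤ F x) (h1 : ∀ x, F x ≤ 1) : Integrable F ν :=
  Integrable.of_bound hF.aestronglyMeasurable 1
    (ae_of_all _ fun x => by rw [Real.norm_eq_abs, abs_of_nonneg (h0 x)]; exact h1 x)

/-- The variance of `f n` under the one-step law from a suitable fixed state tends to zero along a
subsequence: the integrals over the starting state of these variances are the decrements of the
bounded decreasing sequence `∫ (f n)² dμ`. -/
theorem exists_subseq_variance_tendsto_zero (hinv : κ.Invariant μ) (hfm : ∀ n, Measurable (f n))
    (hf0 : ∀ n x, 0 ≤ f n x) (hf1 : ∀ n x, f n x ≤ 1)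
    (hrec : ∀ n x, f (n + 1) x = ∫ y, f n y ∂κ x) :
    ∃ (x : E) (ns : ℕ → ℕ), StrictMono ns ∧
      Tendsto (fun i => ∫ y, (f (ns i) y - f (ns i + 1) x) ^ 2 ∂κ x) atTop (𝓝 0) := by
  have hsq : ∀ (ν : Measure E) [IsFiniteMeasure ν] n, Integrable (fun y => f n y ^ 2) ν :=
    fun ν _ n => integrable_of_mem_unitInterval ((hfm n).pow_const 2) (fun _ => sq_nonneg _)
      fun x => pow_le_one₀ (hf0 n x) (hf1 n x)
  have hfi : ∀ (ν : Measure E) [IsFiniteMeasure ν] n, Integrable (f n) ν := fun ν _ n =>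
    integrable_of_mem_unitInterval (hfm n) (hf0 n) (hf1 n)
  set D : ℕ → E → ℝ := fun n x => ∫ y, (f n y - f (n + 1) x) ^ 2 ∂κ x with hD
  have hDeq : ∀ n x, D n x = ∫ y, f n y ^ 2 ∂κ x - f (n + 1) x ^ 2 := by
    intro n x
    have : ∀ y, (f n y - f (n + 1) x) ^ 2 =
        f n y ^ 2 - 2 * f (n + 1) x * f n y + f (n + 1) x ^ 2 := fun y => by ring
    simp only [hD, this]
    have hi : Integrable (fun y => f n y ^ 2 - 2 * f (n + 1) x * f n y) (κ x) :=
      (hsq _ n).sub ((hfi _ n).const_mul _)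
    rw [integral_add hi (integrable_const _),
      integral_sub (hsq _ n) ((hfi _ n).const_mul _), integral_const_mul, ← hrec]
    simp only [integral_const, probReal_univ, smul_eq_mul, one_mul]
    ring
  have hD0 : ∀ n x, 0 ≤ D n x := fun n x => integral_nonneg fun y => sq_nonneg _
  have hKsq : ∀ n, Integrable (fun x => ∫ y, f n y ^ 2 ∂κ x) μ := fun n =>
    integrable_of_mem_unitInterval (measurable_integral_kernel ((hfm n).pow_const 2))
      (fun x => integral_nonneg fun y => sq_nonneg _) fun x => by
        refine (integral_mono (hsq _ n) (integrable_const 1)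
          fun y => pow_le_one₀ (hf0 n y) (hf1 n y)).trans ?_
        simp
  have hDi : ∀ n, Integrable (D n) μ := fun n => by
    have : D n = fun x => ∫ y, f n y ^ 2 ∂κ x - f (n + 1) x ^ 2 := funext (hDeq n)
    rw [this]; exact (hKsq n).sub (hsq μ (n + 1))
  set V : ℕ → ℝ := fun n => ∫ x, f n x ^ 2 ∂μ
  have hDV : ∀ n, ∫ x, D n x ∂μ = V n - V (n + 1) := fun n => by
    simp_rw [hDeq]
    rw [integral_sub (hKsq n) (hsq μ (n + 1)), hinv.integral_integral (hsq μ n)]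
  have hanti : Antitone V := antitone_nat_of_succ_le fun n => by
    have := integral_nonneg (μ := μ) (f := D n) (hD0 n)
    rw [hDV] at this; linarith
  have hlim : Tendsto (fun n => ∫ x, D n x ∂μ) atTop (𝓝 0) := by
    have hVl := tendsto_atTop_ciInf hanti
      ⟨0, by rintro _ ⟨n, rfl⟩; exact integral_nonneg fun x => sq_nonneg _⟩
    simp_rw [hDV]
    simpa using hVl.sub (hVl.comp (tendsto_add_atTop_nat 1))
  obtain ⟨ns, hns, hae⟩ := exists_subseq_ae_tendsto_zero hD0 hDi hlim
  obtain ⟨x, hx⟩ := hae.exists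
  exact ⟨x, ns, hns, hx⟩

/-- If every one-step law dominates the invariant law, the iterates of a Markov operator on a
bounded function converge in mean to its average. -/
theorem tendsto_integral_abs_sub_average (hinv : κ.Invariant μ) (hac : ∀ x, μ ≪ κ x)
    (hfm : ∀ n, Measurable (f n)) (hf0 : ∀ n x, 0 ≤ f n x) (hf1 : ∀ n x, f n x ≤ 1)
    (hrec : ∀ n x, f (n + 1) x = ∫ y, f n y ∂κ x) :
    Tendsto (fun n => ∫ x, |f n x - ∫ y, f 0 y ∂μ| ∂μ) atTop (𝓝 0) := by
  have hfi : ∀ (ν : Measure E) [IsFiniteMeasure ν] n, Integrable (f n) ν := fun ν _ n =>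
    integrable_of_mem_unitInterval (hfm n) (hf0 n) (hf1 n)
  set a := ∫ y, f 0 y ∂μ
  have hmean : ∀ n, ∫ x, f n x ∂μ = a := by
    intro n
    induction n with
    | zero => rfl
    | succ n ih => simp_rw [hrec]; rw [hinv.integral_integral (hfi μ n), ih]
  have habs : ∀ (ν : Measure E) [IsFiniteMeasure ν] n (c : ℝ),
      Integrable (fun x => |f n x - c|) ν :=
    fun ν _ n c => ((hfi ν n).sub (integrable_const c)).abs
  have hanti : Antitone fun n => ∫ x, |f n x - a| ∂μ := by
    refine antitone_nat_of_succ_le fun n => ?_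
    rw [← hinv.integral_integral (habs μ n a)]
    refine integral_mono (habs μ (n + 1) a) ?_ fun x => ?_
    · refine Integrable.of_bound (C := 1 + |a|) (measurable_integral_kernel
        ((hfm n).sub_const a).abs).aestronglyMeasurable (ae_of_all _ fun x => ?_)
      refine (norm_integral_le_of_norm_le_const (C := 1 + |a|) (ae_of_all _ fun y => ?_)).trans ?_
      · rw [Real.norm_eq_abs, abs_abs]
        exact (abs_sub _ _).trans (by
          rw [abs_of_nonneg (hf0 n y)]; linarith [hf1 n y])
      · simp
    · have : f (n + 1) x - a = ∫ y, (f n y - a) ∂κ x := by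
        rw [integral_sub (hfi _ n) (integrable_const _), ← hrec]; simp
      simp only [this]
      exact abs_integral_le_integral_abs
  obtain ⟨x, ns, hns, hvar⟩ :=
    exists_subseq_variance_tendsto_zero hinv hfm hf0 hf1 hrec
  obtain ⟨ms, hms, hae⟩ := exists_subseq_ae_tendsto_zero
    (F := fun i y => (f (ns i) y - f (ns i + 1) x) ^ 2) (fun _ _ => sq_nonneg _) (fun i => by
      refine Integrable.of_bound (((hfm _).sub_const _).pow_const 2).aestronglyMeasurable 1
        (ae_of_all _ fun y => ?_)
      rw [Real.norm_eq_abs, abs_of_nonneg (sq_nonneg _)]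
      exact (sq_le_one_iff_abs_le_one _).2 (abs_sub_le_iff.2
        ⟨by linarith [hf1 (ns i) y, hf0 (ns i + 1) x],
          by linarith [hf0 (ns i) y, hf1 (ns i + 1) x]⟩)) hvar
  set c : ℕ → ℝ := fun i => f (ns (ms i) + 1) x
  set ks : ℕ → ℕ := fun i => ns (ms i)
  have hksT : Tendsto ks atTop atTop := (hns.comp hms).tendsto_atTop
  -- almost everywhere convergence passes from `κ x` to `μ`, where dominated convergence applies
  have hdct : Tendsto (fun i => ∫ y, |f (ks i) y - c i| ∂μ) atTop (𝓝 0) := by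
    have := tendsto_integral_of_dominated_convergence (μ := μ)
      (F := fun i y => |f (ks i) y - c i|) (f := fun _ => 0) (fun _ => 1)
      (fun i => (habs μ (ks i) (c i)).1) (integrable_const _)
      (fun i => ae_of_all _ fun y => by
        rw [Real.norm_eq_abs, abs_abs]
        exact abs_sub_le_iff.2 ⟨by linarith [hf1 (ks i) y, hf0 (ks i + 1) x],
          by linarith [hf0 (ks i) y, hf1 (ks i + 1) x]⟩)
      (by
        filter_upwards [(hac x).ae_le hae] with y hy
        have := hy.sqrt
        simpa [Real.sqrt_sq_eq_abs] using this)
    simpa using this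
  -- the mean deviation from `a` is decreasing in `n`, so a subsequence decides its limit
  refine (tendsto_iff_tendsto_subseq_of_antitone hanti hksT).2 ?_
  refine squeeze_zero (g := fun i => 2 * ∫ y, |f (ks i) y - c i| ∂μ)
    (fun i => integral_nonneg fun _ => abs_nonneg _) (fun i => ?_) (by simpa using hdct.const_mul 2)
  -- the constants `c i` are close to the average `a`, as all `f n` have mean `a`
  have h1 : |c i - a| ≤ ∫ y, |f (ks i) y - c i| ∂μ := by
    have : a - c i = ∫ y, (f (ks i) y - c i) ∂μ := by
      rw [integral_sub (hfi _ _) (integrable_const _), hmean]; simp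
    rw [abs_sub_comm, this]
    exact abs_integral_le_integral_abs
  calc ∫ y, |f (ks i) y - a| ∂μ
      ≤ ∫ y, (|f (ks i) y - c i| + |c i - a|) ∂μ :=
        integral_mono (habs _ _ _) ((habs _ _ _).add (integrable_const _))
          fun y => abs_sub_le _ _ _
    _ = ∫ y, |f (ks i) y - c i| ∂μ + |c i - a| := by
        rw [integral_add (habs _ _ _) (integrable_const _)]; simp
    _ ≤ 2 * ∫ y, |f (ks i) y - c i| ∂μ := by linarith

end Mixing

section Reversible

/-- Detailed balance tested against a function in place of one of the two sets. -/
theorem ProbabilityTheory.Kernel.IsReversible.setLIntegral_lintegral [IsMarkovKernel κ]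
    (hrev : κ.IsReversible μ) {A : Set E} (hA : MeasurableSet A) {φ : E → ℝ≥0∞}
    (hφ : Measurable φ) :
    ∫⁻ x in A, ∫⁻ y, φ y ∂κ x ∂μ = ∫⁻ x, κ x A * φ x ∂μ := by
  have hmA := Kernel.measurable_coe κ hA
  refine hφ.ennreal_induction (motive := fun φ =>
    ∫⁻ x in A, ∫⁻ y, φ y ∂κ x ∂μ = ∫⁻ x, κ x A * φ x ∂μ) ?_ ?_ ?_
  · intro c s hs
    have h1 : ∀ x, ∫⁻ y, s.indicator (fun _ => c) y ∂κ x = c * κ x s := fun x => by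
      rw [lintegral_indicator_const hs]
    have h2 : ∀ x, κ x A * s.indicator (fun _ => c) x = s.indicator (fun x => c * κ x A) x := by
      intro x; by_cases hx : x ∈ s <;> simp [hx, mul_comm]
    simp_rw [h1, h2]
    rw [lintegral_const_mul _ (Kernel.measurable_coe κ hs), hrev hA hs, lintegral_indicator hs,
      lintegral_const_mul _ hmA]
  · intro f g _ hf hg h1 h2
    have hAf : Measurable fun x => κ x A * f x := hmA.mul hf
    simp only [Pi.add_apply, mul_add]
    simp_rw [lintegral_add_left hf]
    rw [lintegral_add_left hf.lintegral_kernel, h1, h2, lintegral_add_left hAf]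
  · intro f hf hmono h
    have hm2 : Monotone fun n x => κ x A * f n x := fun i j hij x => by
      dsimp only; gcongr; exact hmono hij x
    have hAf : ∀ n, Measurable fun x => κ x A * f n x := fun n => hmA.mul (hf n)
    simp_rw [ENNReal.mul_iSup, lintegral_iSup hf hmono]
    rw [lintegral_iSup (fun n => (hf n).lintegral_kernel)
      (fun i j hij x => lintegral_mono (hmono hij)),
      lintegral_iSup hAf hm2]
    simp_rw [h]

theorem ProbabilityTheory.Kernel.IsReversible.pow [IsMarkovKernel κ]
    (hrev : κ.IsReversible μ) (n : ℕ) : (κ ^ n).IsReversible μ := by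
  induction n with
  | zero =>
    intro A B hA hB
    have h : ∀ S : Set E, MeasurableSet S → ∀ x, (κ ^ 0) x S = S.indicator 1 x := fun S hS x => by
      rw [pow_zero]; exact Measure.dirac_apply' _ hS
    simp_rw [h A hA, h B hB]
    rw [lintegral_indicator_one hB, lintegral_indicator_one hA, Measure.restrict_apply hB,
      Measure.restrict_apply hA, Set.inter_comm]
  | succ n ih =>
    intro A B hA hB
    have h1 : ∀ x, (κ ^ (n + 1)) x B = ∫⁻ y, (κ ^ n) y B ∂κ x := fun x => by
      rw [add_comm, Kernel.pow_add_apply_eq_lintegral _ _ _ _ hB, pow_one]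
    simp_rw [h1, Kernel.pow_succ_apply_eq_lintegral κ n _ hA]
    rw [hrev.setLIntegral_lintegral hA (Kernel.measurable_coe _ hB),
      ih.setLIntegral_lintegral hB (Kernel.measurable_coe _ hA)]
    simp_rw [mul_comm]

theorem abs_measureReal_sub_le_one (ν ν' : Measure E) [IsProbabilityMeasure ν]
    [IsProbabilityMeasure ν'] (A : Set E) : |ν.real A - ν'.real A| ≤ 1 :=
  abs_sub_le_iff.2 ⟨by linarith [measureReal_le_one (μ := ν) (s := A),
      measureReal_nonneg (μ := ν') (s := A)],
    by linarith [measureReal_le_one (μ := ν') (s := A), measureReal_nonneg (μ := ν) (s := A)]⟩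

theorem measurable_measureReal_kernel {A : Set E} (hA : MeasurableSet A) :
    Measurable fun y => (κ y).real A :=
  (Kernel.measurable_coe κ hA).ennreal_toReal

variable [IsMarkovKernel κ] [IsProbabilityMeasure μ]

theorem integrable_mul_pow_sub {ρ : E → ℝ} (hρ : Integrable ρ μ) {A : Set E}
    (hA : MeasurableSet A) (n : ℕ) :
    Integrable (fun y => ρ y * (((κ ^ n) y).real A - μ.real A)) μ :=
  hρ.mul_bdd (c := 1) ((measurable_measureReal_kernel hA).sub_const _).aestronglyMeasurable
    (ae_of_all _ fun _ => abs_measureReal_sub_le_one _ _ A)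

/-- Detailed balance for the centred `n`-step probabilities. -/
theorem setIntegral_pow_real_comm (hrev : κ.IsReversible μ) {A S : Set E}
    (hA : MeasurableSet A) (hS : MeasurableSet S) (n : ℕ) :
    ∫ y in S, (((κ ^ n) y).real A - μ.real A) ∂μ =
      ∫ y in A, (((κ ^ n) y).real S - μ.real S) ∂μ := by
  have hi : ∀ T U : Set E, MeasurableSet T → IntegrableOn (fun y => ((κ ^ n) y).real T) U μ :=
    fun T U hT => integrable_of_mem_unitInterval (measurable_measureReal_kernel hT)
      (fun _ => measureReal_nonneg) fun _ => measureReal_le_one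
  have hl : ∀ T U : Set E, MeasurableSet T → ∫ y in U, ((κ ^ n) y).real T ∂μ =
      (∫⁻ y in U, (κ ^ n) y T ∂μ).toReal := fun T U hT =>
    integral_toReal (Kernel.measurable_coe _ hT).aemeasurable
      (ae_of_all _ fun _ => measure_lt_top _ _)
  rw [integral_sub (hi A S hA) (integrable_const _), integral_sub (hi S A hS) (integrable_const _),
    hl A S hA, hl S A hS, hrev.pow n hS hA]
  simp [mul_comm]

/-- Under a reversible kernel, a starting law that is absolutely continuous converges to `μ`
uniformly over target sets; detailed balance turns the dependence on the target set into a
dependence on the starting density, for which convergence in mean is available. -/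
theorem eventually_abs_integral_pow_sub_le (hrev : κ.IsReversible μ) (hac : ∀ x, μ ≪ κ x)
    {ρ : E → ℝ} (hρ : Integrable ρ μ) : ∀ ε > 0, ∀ᶠ n in atTop, ∀ A, MeasurableSet A →
      |∫ y, ρ y * (((κ ^ n) y).real A - μ.real A) ∂μ| ≤ ε := by
  refine Integrable.induction (μ := μ) (P := fun ρ : E → ℝ => ∀ ε > 0, ∀ᶠ n in atTop,
    ∀ A, MeasurableSet A → |∫ y, ρ y * (((κ ^ n) y).real A - μ.real A) ∂μ| ≤ ε)
    ?_ ?_ ?_ ?_ hρ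
  · intro c S hS _ ε hε
    have hlim := tendsto_integral_abs_sub_average (f := fun n y => ((κ ^ n) y).real S)
      hrev.invariant hac (fun n => measurable_measureReal_kernel hS)
      (fun _ _ => measureReal_nonneg) (fun _ _ => measureReal_le_one) (fun n x => by
        rw [add_comm, Measure.real, Kernel.pow_add_apply_eq_lintegral _ _ _ _ hS, pow_one]
        exact (integral_toReal (Kernel.measurable_coe _ hS).aemeasurable
          (ae_of_all _ fun _ => measure_lt_top _ _)).symm)
    have h0 : ∫ y, ((κ ^ 0) y).real S ∂μ = μ.real S := by
      have : ∀ y, ((κ ^ 0) y).real S = S.indicator 1 y := fun y => by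
        have : (κ ^ 0) y S = S.indicator 1 y := by
          rw [pow_zero]; exact Measure.dirac_apply' _ hS
        rw [Measure.real, this]
        by_cases hy : y ∈ S <;> simp [hy]
      simp_rw [this]
      exact integral_indicator_one hS
    simp only [h0] at hlim
    have hlim' : Tendsto (fun n => |c| * ∫ x, |((κ ^ n) x).real S - μ.real S| ∂μ) atTop (𝓝 0) := by
      simpa using hlim.const_mul |c|
    filter_upwards [hlim'.eventually_le_const hε] with n hn A hA
    have h1 : ∀ y, S.indicator (fun _ => c) y * (((κ ^ n) y).real A - μ.real A) =
        S.indicator (fun y => c * (((κ ^ n) y).real A - μ.real A)) y := fun y => by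
      by_cases hy : y ∈ S <;> simp [hy]
    simp_rw [h1]
    -- detailed balance leaves `A` only as a domain of integration, which may be enlarged
    rw [integral_indicator hS, integral_const_mul, setIntegral_pow_real_comm hrev hA hS, abs_mul]
    refine le_trans ?_ hn
    gcongr
    refine abs_integral_le_integral_abs.trans (setIntegral_le_integral ?_ (ae_of_all _ fun _ =>
      abs_nonneg _))
    exact (Integrable.sub (integrable_of_mem_unitInterval (measurable_measureReal_kernel hS)
      (fun _ => measureReal_nonneg) fun _ => measureReal_le_one) (integrable_const _)).abs
  · intro f g _ hf hg h1 h2 ε hε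
    filter_upwards [h1 (ε / 2) (half_pos hε), h2 (ε / 2) (half_pos hε)] with n hn1 hn2 A hA
    simp only [Pi.add_apply, add_mul]
    rw [integral_add (integrable_mul_pow_sub hf hA n) (integrable_mul_pow_sub hg hA n)]
    exact (abs_add_le _ _).trans (by linarith [hn1 A hA, hn2 A hA])
  · refine isClosed_of_closure_subset fun f hf ε hε => ?_
    obtain ⟨g, hg, hfg⟩ := Metric.mem_closure_iff.1 hf (ε / 2) (half_pos hε)
    filter_upwards [hg (ε / 2) (half_pos hε)] with n hn A hA
    have hfi := L1.integrable_coeFn f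
    have hgi := L1.integrable_coeFn g
    have hsub : Integrable (fun y => f y - g y) μ := hfi.sub hgi
    have h1 : |∫ y, (f y - g y) * (((κ ^ n) y).real A - μ.real A) ∂μ| ≤ ε / 2 := by
      refine le_trans ?_ hfg.le
      rw [L1.dist_eq_integral_dist]
      refine abs_integral_le_integral_abs.trans (integral_mono
        (integrable_mul_pow_sub hsub hA n).abs
        (by simpa only [dist_eq_norm] using hsub.norm) fun y => ?_)
      dsimp only
      rw [abs_mul, Real.dist_eq]
      exact mul_le_of_le_one_right (abs_nonneg _) (abs_measureReal_sub_le_one _ _ A)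
    have h2 : ∫ y, f y * (((κ ^ n) y).real A - μ.real A) ∂μ =
        ∫ y, (f y - g y) * (((κ ^ n) y).real A - μ.real A) ∂μ +
          ∫ y, g y * (((κ ^ n) y).real A - μ.real A) ∂μ := by
      rw [← integral_add (integrable_mul_pow_sub hsub hA n)
        (integrable_mul_pow_sub hgi hA n)]
      congr with y
      ring
    rw [h2]
    exact (abs_add_le _ _).trans (by linarith [hn A hA])
  · intro f g hfg _ h ε hε
    filter_upwards [h ε hε] with n hn A hA
    have : ∫ y, g y * (((κ ^ n) y).real A - μ.real A) ∂μ =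
        ∫ y, f y * (((κ ^ n) y).real A - μ.real A) ∂μ :=
      integral_congr_ae (hfg.mono fun y hy => by simp only [hy])
    rw [this]; exact hn A hA

/-- A reversible Markov kernel converges in total variation from every state if every one-step law
dominates `μ` and is, up to a holding probability less than one, dominated by `μ`. -/
theorem tendsto_tvDistance_pow (hrev : κ.IsReversible μ) (hac : ∀ x, μ ≪ κ x)
    (hdec : ∀ x, ∃ (ν : Measure E) (c : ℝ≥0∞), c < 1 ∧ ν ≪ μ ∧
      κ x = ν + c • Measure.dirac x) (x : E) :
    Tendsto (fun n : ℕ => tvDistance ((κ ^ n) x) μ) atTop (𝓝 0) := by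
  obtain ⟨ν, c, hc, hν, hκ⟩ := hdec x
  have hcfin : c ≠ ∞ := (hc.trans ENNReal.one_lt_top).ne
  set r := c.toReal with hr
  have hr0 : 0 ≤ r := ENNReal.toReal_nonneg
  have hr1 : r < 1 := by
    simpa using (ENNReal.toReal_lt_toReal hcfin ENNReal.one_ne_top).2 hc
  have : IsFiniteMeasure ν := ⟨by
    refine lt_of_le_of_lt ?_ (measure_lt_top (κ x) Set.univ)
    rw [hκ]; exact le_self_add⟩
  have hρ : Integrable (fun y => (ν.rnDeriv μ y).toReal) μ := Measure.integrable_toReal_rnDeriv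
  have hrec : ∀ n A, MeasurableSet A → ((κ ^ (n + 1)) x).real A - μ.real A =
      ∫ y, (ν.rnDeriv μ y).toReal * (((κ ^ n) y).real A - μ.real A) ∂μ +
        r * (((κ ^ n) x).real A - μ.real A) := by
    intro n A hA
    have hm : Measurable fun y => ((κ ^ n) y).real A - μ.real A :=
      (measurable_measureReal_kernel hA).sub_const _
    have hb : ∀ ξ : Measure E, IsFiniteMeasure ξ →
        Integrable (fun y => ((κ ^ n) y).real A - μ.real A) ξ := fun ξ _ =>
      Integrable.of_bound hm.aestronglyMeasurable 1
        (ae_of_all _ fun _ => abs_measureReal_sub_le_one _ _ A)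
    have h1 : ((κ ^ (n + 1)) x).real A - μ.real A =
        ∫ y, (((κ ^ n) y).real A - μ.real A) ∂κ x := by
      rw [integral_sub (integrable_of_mem_unitInterval (measurable_measureReal_kernel hA)
        (fun _ => measureReal_nonneg) fun _ => measureReal_le_one) (integrable_const _),
        add_comm n, Measure.real, Kernel.pow_add_apply_eq_lintegral _ _ _ _ hA, pow_one]
      have := integral_toReal (μ := κ x) (Kernel.measurable_coe (κ ^ n) hA).aemeasurable
          (ae_of_all _ fun _ => measure_lt_top _ _)
      simp only [Measure.real] at this ⊢
      rw [this]
      simp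
    have hsm : IsFiniteMeasure (c • Measure.dirac x) := Measure.smul_finite _ hcfin
    rw [h1, hκ, integral_add_measure (hb _ inferInstance) (hb _ hsm), integral_smul_measure,
      integral_dirac' _ _ hm.stronglyMeasurable, smul_eq_mul, ← hr]
    congr 1
    simpa only [smul_eq_mul] using
      (integral_rnDeriv_smul hν (f := fun y => ((κ ^ n) y).real A - μ.real A)).symm
  rw [Metric.tendsto_atTop]
  intro ε hε
  obtain ⟨N, hN⟩ := eventually_atTop.1 (eventually_abs_integral_pow_sub_le hrev hac hρ
    (ε / 3 * (1 - r)) (mul_pos (by positivity) (by linarith)))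
  -- iterate `e (n + 1) ≤ ε / 3 * (1 - r) + r * e n` from time `N` on
  have hgeo : ∀ k A, MeasurableSet A →
      |((κ ^ (N + k)) x).real A - μ.real A| ≤ ε / 3 + r ^ k := by
    intro k A hA
    induction k with
    | zero => exact (abs_measureReal_sub_le_one _ _ A).trans (by rw [pow_zero]; linarith)
    | succ k ih =>
      rw [← add_assoc, hrec _ A hA]
      refine (abs_add_le _ _).trans ?_
      rw [abs_mul, abs_of_nonneg hr0]
      have h1 := hN (N + k) (Nat.le_add_right _ _) A hA
      have h2 := mul_le_mul_of_nonneg_left ih hr0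
      rw [pow_succ]
      linarith
  obtain ⟨M, hM⟩ := eventually_atTop.1
    ((tendsto_pow_atTop_nhds_zero_of_lt_one hr0 hr1).eventually_le_const
      (show (0 : ℝ) < ε / 3 by positivity))
  refine ⟨N + M, fun n hn => ?_⟩
  obtain ⟨k, rfl⟩ := Nat.exists_eq_add_of_le hn
  have hle : tvDistance ((κ ^ (N + M + k)) x) μ ≤ ε / 3 + ε / 3 := by
    refine Real.iSup_le (fun A => ?_) (by positivity)
    rw [add_assoc]
    exact (hgeo (M + k) A.1 A.2).trans (by linarith [hM (M + k) (Nat.le_add_right _ _)])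
  have h0 : 0 ≤ tvDistance ((κ ^ (N + M + k)) x) μ := Real.iSup_nonneg fun _ => abs_nonneg _
  rw [Real.dist_eq, sub_zero, abs_of_nonneg h0]
  linarith

end Reversible

end TotalVariation

/-! ### The random dive kernel in multiplicative coordinates -/

section MultiplicativeHaar

theorem measurableEmbedding_rstar : MeasurableEmbedding (Subtype.val : RStar → ℝ) :=
  MeasurableEmbedding.subtype_coe (measurableSet_singleton (0 : ℝ)).compl

theorem comap_val_withDensity (ν : Measure ℝ) (φ : ℝ → ℝ≥0∞) :
    (ν.withDensity φ).comap (Subtype.val : RStar → ℝ) =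
      (ν.comap Subtype.val).withDensity (fun y : RStar => φ y) := by
  have he := measurableEmbedding_rstar
  ext A hA
  rw [he.comap_apply, withDensity_apply _ (he.measurableSet_image' hA), withDensity_apply _ hA,
    ← lintegral_indicator hA, ← lintegral_indicator (he.measurableSet_image' hA)]
  have h1 : ∀ y : RStar, A.indicator (fun y : RStar => φ y) y =
      (Subtype.val '' A).indicator φ y.1 := fun y => by
    by_cases hy : y ∈ A
    · rw [Set.indicator_of_mem hy, Set.indicator_of_mem (Set.mem_image_of_mem _ hy)]
    · rw [Set.indicator_of_notMem hy, Set.indicator_of_notMem]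
      rwa [Subtype.val_injective.mem_set_image]
  simp_rw [h1]
  rw [← he.lintegral_map, he.map_comap, ← lintegral_indicator he.measurableSet_range]
  refine lintegral_congr fun t => ?_
  by_cases ht : t ∈ Set.range (Subtype.val : RStar → ℝ)
  · rw [Set.indicator_of_mem ht]
  · rw [Set.indicator_of_notMem ht, Set.indicator_of_notMem]
    rintro ⟨y, _, rfl⟩
    exact ht ⟨y, rfl⟩

/-- The measure `dy / |y|` on `ℝ*`, a Haar measure of the multiplicative group. -/
noncomputable def haarStar : Measure RStar :=
  (volume.comap Subtype.val).withDensity (fun y : RStar => ENNReal.ofReal |y.1|⁻¹)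

theorem lintegral_haarStar (G : ℝ → ℝ≥0∞) (hG : Measurable G) :
    ∫⁻ y, G y.1 ∂haarStar = ∫⁻ t in ({0}ᶜ : Set ℝ), ENNReal.ofReal |t|⁻¹ * G t := by
  rw [haarStar, lintegral_withDensity_eq_lintegral_mul _ (by fun_prop) (by fun_prop)]
  have he := measurableEmbedding_rstar
  have := he.lintegral_map (μ := volume.comap (Subtype.val : RStar → ℝ))
    (fun t => ENNReal.ofReal |t|⁻¹ * G t)
  rw [he.map_comap, Subtype.range_coe] at this
  rw [this]
  rfl

/-- Haar measure of `ℝ*` is unchanged by a bijection of `ℝ*` whose derivative `f'` satisfies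
`|f'(t)| = |f(t)| / |t|`. -/
theorem lintegral_comp_haarStar {f f' : ℝ → ℝ} {e : RStar → RStar} (he : ∀ ε, (e ε).1 = f ε.1)
    (himg : f '' ({0}ᶜ : Set ℝ) = {0}ᶜ) (hinj : Set.InjOn f ({0}ᶜ : Set ℝ)) (hfm : Measurable f)
    (hderiv : ∀ t ∈ ({0}ᶜ : Set ℝ), HasDerivAt f (f' t) t)
    (hf' : ∀ t ∈ ({0}ᶜ : Set ℝ), |f' t| * |f t|⁻¹ = |t|⁻¹)
    {G : RStar → ℝ≥0∞} (hG : Measurable G) :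
    ∫⁻ ε, G (e ε) ∂haarStar = ∫⁻ y, G y ∂haarStar := by
  have hS : MeasurableSet ({0}ᶜ : Set ℝ) := (measurableSet_singleton _).compl
  obtain ⟨G', hG', rfl⟩ := measurableEmbedding_rstar.exists_measurable_extend hG fun _ => ⟨0⟩
  simp only [Function.comp_apply, he]
  rw [lintegral_haarStar _ hG', lintegral_haarStar (fun t => G' (f t)) (hG'.comp hfm)]
  have h := lintegral_image_eq_lintegral_abs_deriv_mul hS
    (fun t ht => (hderiv t ht).hasDerivWithinAt) hinj
    (fun t => ENNReal.ofReal |t|⁻¹ * G' t)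
  rw [himg] at h
  rw [h]
  refine setLIntegral_congr_fun hS fun t ht => ?_
  rw [← mul_assoc, ← ENNReal.ofReal_mul (abs_nonneg _), hf' t ht]

theorem lintegral_inner_haarStar (x : RStar) {G : RStar → ℝ≥0∞} (hG : Measurable G) :
    ∫⁻ ε, G (x.inner ε) ∂haarStar = ∫⁻ y, G y ∂haarStar := by
  have hx : x.1 ≠ 0 := x.2
  refine lintegral_comp_haarStar (f := fun t => x.1 * t) (f' := fun _ => x.1) (fun _ => rfl)
    ?_ (fun s _ t _ h => mul_left_cancel₀ hx h) (by fun_prop) (fun t _ => ?_) (fun t _ => ?_) hG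
  · ext t
    refine ⟨?_, fun ht => ⟨t / x.1, div_ne_zero ht hx, by field_simp⟩⟩
    rintro ⟨s, hs, rfl⟩
    exact mul_ne_zero hx hs
  · simpa using (hasDerivAt_id t).const_mul x.1
  · have := abs_pos.2 hx
    rw [abs_mul, mul_inv, mul_inv_cancel_left₀ this.ne']

theorem lintegral_outer_haarStar (x : RStar) {G : RStar → ℝ≥0∞} (hG : Measurable G) :
    ∫⁻ ε, G (x.outer ε) ∂haarStar = ∫⁻ y, G y ∂haarStar := by
  have hx : x.1 ≠ 0 := x.2
  refine lintegral_comp_haarStar (f := fun t => x.1 / t) (f' := fun t => -(x.1 / t ^ 2))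
    (fun _ => rfl) ?_ (fun s hs t ht h => ?_) (by fun_prop) (fun t ht => ?_) (fun t ht => ?_) hG
  · ext t
    refine ⟨?_, fun ht => ⟨x.1 / t, div_ne_zero hx ht, ?_⟩⟩
    · rintro ⟨s, hs, rfl⟩
      exact div_ne_zero hx hs
    · have : t ≠ 0 := ht
      field_simp
  · have hs' : s ≠ 0 := hs
    have ht' : t ≠ 0 := ht
    have h' : x.1 / s = x.1 / t := h
    rw [div_eq_div_iff hs' ht'] at h'
    exact (mul_left_cancel₀ hx h').symm
  · have ht' : t ≠ 0 := ht
    have := (hasDerivAt_inv ht').const_mul x.1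
    simpa only [div_eq_mul_inv, mul_neg] using this
  · have ht' : 0 < |t| := abs_pos.2 ht
    have := abs_pos.2 hx
    rw [abs_neg, abs_div, abs_div, abs_pow]
    field_simp

/-- Densities with respect to Lebesgue measure, rewritten with respect to Haar measure. -/
theorem comap_withDensity_eq_haarStar {φ : ℝ → ℝ≥0∞} (hφ : Measurable φ) :
    (volume.withDensity φ).comap (Subtype.val : RStar → ℝ) =
      haarStar.withDensity (fun y : RStar => φ y * ENNReal.ofReal |y.1|) := by
  rw [comap_val_withDensity, haarStar, ← withDensity_mul _ (by fun_prop) (by fun_prop)]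
  congr 1 with y
  have hy : |y.1| ≠ 0 := abs_ne_zero.2 y.2
  simp only [Pi.mul_apply]
  rw [mul_left_comm, ← ENNReal.ofReal_mul (by positivity), inv_mul_cancel₀ hy, ENNReal.ofReal_one,
    mul_one]

end MultiplicativeHaar

/-! ### Densities of the random dive kernel -/

section Density

/-- The density of the target with respect to Haar measure, up to normalization. -/
noncomputable def TargetDensity.haarDensity (π : TargetDensity) (x : RStar) : ℝ := π x * |x.1|

/-- The density of the multiplier with respect to Haar measure. -/
noncomputable def DiveDensity.haarDensity (g : DiveDensity) (ε : RStar) : ℝ≥0∞ :=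
  (Set.Ioo (-1 : ℝ) 1 \ {0}).indicator (fun t => ENNReal.ofReal (g t)) ε * ENNReal.ofReal |ε.1|

theorem measurable_haarDensity_target (π : TargetDensity) : Measurable π.haarDensity := by
  have h : Measurable fun x : RStar => π x := π.measurable.comp measurable_subtype_coe
  unfold TargetDensity.haarDensity
  fun_prop

theorem measurable_indicator_dive (g : DiveDensity) : Measurable
    ((Set.Ioo (-1 : ℝ) 1 \ {0}).indicator (fun t => ENNReal.ofReal (g t))) :=
  (ENNReal.measurable_ofReal.comp g.measurable).indicator
    (measurableSet_Ioo.diff (measurableSet_singleton _))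

theorem measurable_haarDensity_dive (g : DiveDensity) : Measurable g.haarDensity := by
  have := (measurable_indicator_dive g).comp (measurable_subtype_coe (p := (· ∈ ({0}ᶜ : Set ℝ))))
  exact this.mul (by fun_prop)

theorem law_eq_haarStar (g : DiveDensity) : g.law = haarStar.withDensity g.haarDensity := by
  rw [DiveDensity.law, ← withDensity_indicator (measurableSet_Ioo.diff (measurableSet_singleton _)),
    comap_withDensity_eq_haarStar (measurable_indicator_dive g)]
  rfl

theorem lawStar_eq_haarStar (π : TargetDensity) : π.lawStar =
    haarStar.withDensity (fun y => ENNReal.ofReal (π.haarDensity y / ∫ t, π t)) := by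
  have hm : Measurable fun t => ENNReal.ofReal (π t / ∫ y, π y) :=
    ENNReal.measurable_ofReal.comp (π.measurable.div_const _)
  rw [TargetDensity.lawStar, TargetDensity.law, comap_withDensity_eq_haarStar hm]
  congr 1 with y
  rw [TargetDensity.haarDensity, ← ENNReal.ofReal_mul
    (div_nonneg (π.nonneg _) π.integral_pos.le)]
  congr 1; ring

/-- The symmetric proposal density `q(x, y)` of the dive moves with respect to Haar measure. -/
noncomputable def proposalDensity (g : DiveDensity) (x y : RStar) : ℝ≥0∞ :=
  2⁻¹ * (g.haarDensity (y.outer x) + g.haarDensity (x.outer y))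

theorem proposalDensity_comm (g : DiveDensity) (x y : RStar) :
    proposalDensity g x y = proposalDensity g y x := by
  rw [proposalDensity, proposalDensity, add_comm]

theorem measurable_proposalDensity (g : DiveDensity) :
    Measurable (Function.uncurry (proposalDensity g)) := by
  have h1 := (measurable_haarDensity_dive g).comp RStar.measurable_outer
  have h2 := h1.comp measurable_swap
  exact (h2.add h1).const_mul _

/-- The Metropolis acceptance probability in terms of the Haar densities. -/
noncomputable def haarAccept (π : TargetDensity) (x y : RStar) : ℝ :=
  min (π.haarDensity y / π.haarDensity x) 1

theorem innerAccept_eq (π : TargetDensity) (x ε : RStar) :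
    innerAccept π x ε = haarAccept π x (x.inner ε) := by
  have hx : |x.1| ≠ 0 := abs_ne_zero.2 x.2
  have h : |(x.inner ε).1| = |x.1| * |ε.1| := abs_mul _ _
  rw [innerAccept, haarAccept, TargetDensity.haarDensity, TargetDensity.haarDensity, h]
  congr 1
  rw [mul_div_mul_comm, mul_div_cancel_left₀ _ hx]

theorem outerAccept_eq (π : TargetDensity) (x ε : RStar) :
    outerAccept π x ε = haarAccept π x (x.outer ε) := by
  have hx : |x.1| ≠ 0 := abs_ne_zero.2 x.2
  have h : |(x.outer ε).1| = |x.1| * (1 / |ε.1|) := by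
    rw [mul_one_div]; exact abs_div _ _
  rw [outerAccept, haarAccept, TargetDensity.haarDensity, TargetDensity.haarDensity, h]
  congr 1
  rw [mul_div_mul_comm, mul_div_cancel_left₀ _ hx]

/-- The probability that a move from `x` is rejected. -/
noncomputable def rejection (π : TargetDensity) (g : DiveDensity) (x : RStar) : ℝ≥0∞ :=
  ∫⁻ ε, (2⁻¹ * ENNReal.ofReal (1 - innerAccept π x ε) +
    2⁻¹ * ENNReal.ofReal (1 - outerAccept π x ε)) ∂g.law

theorem RStar.outer_inner (x ε : RStar) : (x.inner ε).outer x = ε := by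
  apply Subtype.ext
  exact mul_div_cancel_left₀ _ x.2

theorem RStar.outer_outer (x ε : RStar) : x.outer (x.outer ε) = ε := by
  apply Subtype.ext
  exact div_div_cancel₀ x.2

theorem measurable_haarAccept (π : TargetDensity) (x : RStar) : Measurable (haarAccept π x) :=
  ((measurable_haarDensity_target π).div_const _).min measurable_const

/-- One step of the chain: an accepted move, with a density with respect to Haar measure, or a
rejection. -/
theorem rdmhKernel_eq_haarStar (π : TargetDensity) (g : DiveDensity) (x : RStar) :
    rdmhKernel π g x =
      haarStar.withDensity
        (fun y => proposalDensity g x y * ENNReal.ofReal (haarAccept π x y)) +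
        rejection π g x • Measure.dirac x := by
  ext A hA
  have hi : Measurable fun ε => x.inner ε :=
    RStar.measurable_inner.comp (measurable_const.prodMk measurable_id)
  have ho : Measurable fun ε => x.outer ε :=
    RStar.measurable_outer.comp (measurable_const.prodMk measurable_id)
  have ho' : Measurable fun y : RStar => y.outer x :=
    RStar.measurable_outer.comp (measurable_id.prodMk measurable_const)
  have hH := measurable_haarDensity_dive g
  have hone : Measurable (A.indicator (1 : RStar → ℝ≥0∞)) := measurable_one.indicator hA
  set w : RStar → ℝ≥0∞ := fun y =>
    2⁻¹ * (ENNReal.ofReal (haarAccept π x y) * A.indicator 1 y) with hw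
  have hwm : Measurable w :=
    (((measurable_haarAccept π x).ennreal_ofReal).mul hone).const_mul _
  have hrm : Measurable fun ε => 2⁻¹ * ENNReal.ofReal (1 - innerAccept π x ε) +
      2⁻¹ * ENNReal.ofReal (1 - outerAccept π x ε) := by
    simp_rw [innerAccept_eq, outerAccept_eq]
    have h1 := (measurable_haarAccept π x).comp hi
    have h2 := (measurable_haarAccept π x).comp ho
    simp only [Function.comp_def] at h1 h2
    fun_prop
  have hwi : Measurable fun ε => w (x.inner ε) := hwm.comp hi
  have hwo : Measurable fun ε => w (x.outer ε) := hwm.comp ho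
  have hwio : Measurable fun ε => w (x.inner ε) + w (x.outer ε) := hwi.add hwo
  have hgi : Measurable fun y : RStar => g.haarDensity (y.outer x) * w y := (hH.comp ho').mul hwm
  have hstep : ∀ ε, diveStep π x ε A = w (x.inner ε) + w (x.outer ε) +
      (2⁻¹ * ENNReal.ofReal (1 - innerAccept π x ε) +
        2⁻¹ * ENNReal.ofReal (1 - outerAccept π x ε)) * A.indicator 1 x := by
    intro ε
    simp only [diveStep, acceptReject, Measure.add_apply, Measure.smul_apply, smul_eq_mul,
      Measure.dirac_apply' _ hA, one_div, hw, ← innerAccept_eq, ← outerAccept_eq]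
    ring
  rw [rdmhKernel_apply π g x hA]
  simp_rw [hstep]
  rw [lintegral_add_left hwio, lintegral_mul_const _ hrm,
    lintegral_add_left hwi, Measure.add_apply, Measure.smul_apply, smul_eq_mul,
    Measure.dirac_apply' _ hA, ← rejection, withDensity_apply _ hA, law_eq_haarStar,
    lintegral_withDensity_eq_lintegral_mul _ hH hwi,
    lintegral_withDensity_eq_lintegral_mul _ hH hwo]
  congr 1
  -- substitute `y = x ε` in the inner dives and `y = x / ε` in the outer ones
  have hin := lintegral_inner_haarStar x (G := fun y => g.haarDensity (y.outer x) * w y) hgi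
  have hout := lintegral_outer_haarStar x (G := fun y => g.haarDensity (x.outer y) * w y)
    ((hH.comp ho).mul hwm)
  simp only [RStar.outer_inner] at hin
  simp only [RStar.outer_outer] at hout
  simp only [Pi.mul_apply]
  rw [hin, hout, ← lintegral_add_left hgi, ← lintegral_indicator hA]
  refine lintegral_congr fun y => ?_
  by_cases hy : y ∈ A
  · simp only [hw, proposalDensity, Set.indicator_of_mem hy, Pi.one_apply]; ring
  · simp [hw, hy]

/-- The density of an accepted move with respect to the target distribution. Since
`min (p y / p x) 1 / p y = 1 / max (p x) (p y)`, it is symmetric. -/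
noncomputable def moveDensity (π : TargetDensity) (g : DiveDensity) (x y : RStar) : ℝ≥0∞ :=
  proposalDensity g x y *
    ENNReal.ofReal ((∫ t, π t) / max (π.haarDensity x) (π.haarDensity y))

theorem moveDensity_comm (π : TargetDensity) (g : DiveDensity) (x y : RStar) :
    moveDensity π g x y = moveDensity π g y x := by
  rw [moveDensity, moveDensity, proposalDensity_comm, max_comm]

theorem measurable_moveDensity (π : TargetDensity) (g : DiveDensity) :
    Measurable (Function.uncurry (moveDensity π g)) := by
  have h1 : Measurable fun p : RStar × RStar => π.haarDensity p.1 :=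
    (measurable_haarDensity_target π).comp measurable_fst
  have h2 : Measurable fun p : RStar × RStar => π.haarDensity p.2 :=
    (measurable_haarDensity_target π).comp measurable_snd
  have h3 : Measurable fun p : RStar × RStar =>
      ENNReal.ofReal ((∫ t, π t) / max (π.haarDensity p.1) (π.haarDensity p.2)) :=
    (measurable_const.div (h1.max h2)).ennreal_ofReal
  exact (measurable_proposalDensity g).mul h3

theorem measurable_moveDensity_right (π : TargetDensity) (g : DiveDensity) (x : RStar) :
    Measurable (moveDensity π g x) :=
  (measurable_moveDensity π g).of_uncurry_left

variable {π : TargetDensity} {g : DiveDensity}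

theorem haarDensity_pos (hπ : ∀ x, 0 < π x) (x : RStar) : 0 < π.haarDensity x :=
  mul_pos (hπ _) (abs_pos.2 x.2)

theorem rdmhKernel_eq (hπ : ∀ x, 0 < π x) (x : RStar) : rdmhKernel π g x =
    π.lawStar.withDensity (moveDensity π g x) + rejection π g x • Measure.dirac x := by
  rw [rdmhKernel_eq_haarStar, lawStar_eq_haarStar, ← withDensity_mul _
    ((measurable_haarDensity_target π).div_const _).ennreal_ofReal
    (measurable_moveDensity_right π g x)]
  congr 2 with y
  have hx := haarDensity_pos hπ x
  have hy := haarDensity_pos hπ y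
  have hZ := π.integral_pos
  have hkey : haarAccept π x y = π.haarDensity y / (∫ t, π t) *
      ((∫ t, π t) / max (π.haarDensity x) (π.haarDensity y)) := by
    rw [div_mul_div_cancel₀ hZ.ne', haarAccept]
    rcases le_total (π.haarDensity x) (π.haarDensity y) with h | h
    · rw [max_eq_right h, div_self hy.ne', min_eq_right ((one_le_div hx).2 h)]
    · rw [max_eq_left h, min_eq_left ((div_le_one hx).2 h)]
  rw [Pi.mul_apply, moveDensity, hkey, ENNReal.ofReal_mul (div_pos hy hZ).le]
  ring

theorem isReversible_rdmhKernel (hπ : ∀ x, 0 < π x) :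
    (rdmhKernel π g).IsReversible π.lawStar := by
  intro A B hA hB
  have hm := measurable_moveDensity π g
  have hexp : ∀ A B : Set RStar, MeasurableSet A → MeasurableSet B →
      ∫⁻ x in A, rdmhKernel π g x B ∂π.lawStar =
        ∫⁻ x in A, ∫⁻ y in B, moveDensity π g x y ∂π.lawStar ∂π.lawStar +
          ∫⁻ x in B ∩ A, rejection π g x ∂π.lawStar := by
    intro A B hA hB
    have h1 : ∀ x, rdmhKernel π g x B = ∫⁻ y in B, moveDensity π g x y ∂π.lawStar +
        B.indicator (rejection π g) x := fun x => by
      rw [rdmhKernel_eq hπ, Measure.add_apply, withDensity_apply _ hB, Measure.smul_apply,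
        smul_eq_mul, Measure.dirac_apply' _ hB]
      by_cases hx : x ∈ B <;> simp [hx]
    have hmB : Measurable fun x => ∫⁻ y in B, moveDensity π g x y ∂π.lawStar :=
      hm.lintegral_prod_right'
    simp_rw [h1]
    rw [lintegral_add_left hmB, lintegral_indicator hB,
      Measure.restrict_restrict hB]
  rw [hexp A B hA hB, hexp B A hB hA, Set.inter_comm, lintegral_lintegral_swap hm.aemeasurable]
  simp_rw [moveDensity_comm]

theorem ae_moveDensity_ne_zero (hπ : ∀ x, 0 < π x)
    (hg : ∀ t : ℝ, t ≠ 0 → |t| < 1 → 0 < g t) (x : RStar) :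
    ∀ᵐ y ∂π.lawStar, moveDensity π g x y ≠ 0 := by
  have hH : ∀ ε : RStar, |ε.1| < 1 → g.haarDensity ε ≠ 0 := fun ε hε => by
    have h0 : ε.1 ≠ 0 := ε.2
    have hmem : ε.1 ∈ Set.Ioo (-1 : ℝ) 1 \ {0} := ⟨abs_lt.1 hε, h0⟩
    rw [DiveDensity.haarDensity, Set.indicator_of_mem hmem]
    exact mul_ne_zero (ENNReal.ofReal_pos.2 (hg _ h0 hε)).ne'
      (ENNReal.ofReal_pos.2 (abs_pos.2 h0)).ne'
  have hnull : π.lawStar {y : RStar | |y.1| = |x.1|} = 0 := by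
    rw [TargetDensity.lawStar, measurableEmbedding_rstar.comap_apply, TargetDensity.law]
    refine withDensity_absolutelyContinuous _ _ (measure_mono_null (t := {x.1, -x.1}) ?_ ?_)
    · rintro _ ⟨y, hy, rfl⟩
      exact abs_eq_abs.1 hy
    · exact (Set.toFinite _).measure_zero _
  filter_upwards [measure_eq_zero_iff_ae_notMem.1 hnull] with y hy
  have hx0 : 0 < |x.1| := abs_pos.2 x.2
  have hy0 : 0 < |y.1| := abs_pos.2 y.2
  refine mul_ne_zero (mul_ne_zero (by simp) fun h => ?_) (ENNReal.ofReal_pos.2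
    (div_pos π.integral_pos (lt_max_of_lt_left (haarDensity_pos hπ x)))).ne'
  obtain ⟨h1, h2⟩ := add_eq_zero.1 h
  rcases lt_or_gt_of_ne (show |y.1| ≠ |x.1| from hy) with hlt | hlt
  · refine hH _ ?_ h1
    change |y.1 / x.1| < 1
    rwa [abs_div, div_lt_one hx0]
  · refine hH _ ?_ h2
    change |x.1 / y.1| < 1
    rwa [abs_div, div_lt_one hy0]

theorem lawStar_absolutelyContinuous_rdmhKernel (hπ : ∀ x, 0 < π x)
    (hg : ∀ t : ℝ, t ≠ 0 → |t| < 1 → 0 < g t) (x : RStar) : π.lawStar ≪ rdmhKernel π g x := by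
  rw [rdmhKernel_eq hπ]
  exact (withDensity_absolutelyContinuous' (measurable_moveDensity_right π g x).aemeasurable
    (ae_moveDensity_ne_zero hπ hg x)).add_right _

theorem rejection_lt_one (hπ : ∀ x, 0 < π x)
    (hg : ∀ t : ℝ, t ≠ 0 → |t| < 1 → 0 < g t) (x : RStar) : rejection π g x < 1 := by
  have hpos : π.lawStar.withDensity (moveDensity π g x) Set.univ ≠ 0 := fun h => by
    have hac := withDensity_absolutelyContinuous' (μ := π.lawStar)
      (measurable_moveDensity_right π g x).aemeasurable (ae_moveDensity_ne_zero hπ hg x)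
    simpa using hac h
  have htot : π.lawStar.withDensity (moveDensity π g x) Set.univ + rejection π g x = 1 := by
    have := congrArg (fun ν : Measure RStar => ν Set.univ) (rdmhKernel_eq (g := g) hπ x)
    simpa using this.symm
  have hfin : rejection π g x ≠ ∞ := fun h => by simp [h] at htot
  calc rejection π g x < π.lawStar.withDensity (moveDensity π g x) Set.univ + rejection π g x := by
        rw [add_comm]; exact ENNReal.lt_add_right hfin hpos
    _ = 1 := htot

/-- A positive infimum of `g` on every punctured annulus makes `g` positive on `𝒴`. If `g` is
unbounded below on the annulus, the infimum is `0` by convention, which is excluded. -/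
theorem dive_pos_of_sInf_pos
    (hg : ∀ δ : ℝ, 0 < δ → δ < 1 → 0 < sInf (g '' {ε : ℝ | δ < |ε| ∧ |ε| < 1}))
    {t : ℝ} (ht : t ≠ 0) (ht1 : |t| < 1) : 0 < g t := by
  have h0 := abs_pos.2 ht
  have h := hg (|t| / 2) (by linarith) (by linarith)
  have hbdd : BddBelow (g '' {ε : ℝ | |t| / 2 < |ε| ∧ |ε| < 1}) := by
    by_contra hb
    rw [Real.sInf_of_not_bddBelow hb] at h
    exact h.false
  exact h.trans_le (csInf_le hbdd ⟨t, ⟨by linarith, ht1⟩, rfl⟩)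

end Density

theorem mainTheorem5 (π : TargetDensity) (g : DiveDensity)
    (hg : ∀ δ : ℝ, 0 < δ → δ < 1 → 0 < sInf (g '' {ε : ℝ | δ < |ε| ∧ |ε| < 1}))
    (hπ : ∀ C : Set ℝ, IsCompact C → BddAbove (π '' C) ∧ ∀ x ∈ C, 0 < π x) :
    IsHarrisRecurrent (rdmhKernel π g) π.lawStar ∧
      ∀ x : RStar, Tendsto (fun n : ℕ => tvDistance ((rdmhKernel π g ^ n) x) π.lawStar)
        atTop (𝓝 0) := by
  have hπ' : ∀ x, 0 < π x := fun x => (hπ {x} isCompact_singleton).2 x rfl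
  have hg' : ∀ t : ℝ, t ≠ 0 → |t| < 1 → 0 < g t := fun t => dive_pos_of_sInf_pos hg
  have hrev := isReversible_rdmhKernel (g := g) hπ'
  have hac := lawStar_absolutelyContinuous_rdmhKernel hπ' hg'
  have hdec : ∀ x, ∃ (ν : Measure RStar) (c : ℝ≥0∞), c < 1 ∧ ν ≪ π.lawStar ∧
      rdmhKernel π g x = ν + c • Measure.dirac x := fun x =>
    ⟨_, _, rejection_lt_one hπ' hg' x, withDensity_absolutelyContinuous _ _, rdmhKernel_eq hπ' x⟩
  exact ⟨isHarrisRecurrent_of_invariant hrev.invariant hac hdec,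
    tendsto_tvDistance_pow hrev hac hdec⟩
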